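/- Let $G$ be a finite directed graph with vertex set $V(G)$ and edge set $E(G)$ (loops and multiple edges are allowed). A directed cycle of $G$ is a sequence $v_0,x_0,v_1,x_1,\dots,v_n,x_n,v_0$ ($n\ge 0$) with $v_0,\dots,v_n$ pairwise distinct vertices and each $x_i$ an edge from $v_i$ to $v_{i+1}$ (where $v_{n+1}=v_0$), considered up to circular permutation. Let $\alpha(G)$ be the maximal number of pairwise edge-disjoint directed cycles in $G$, and $\tilde\alpha(G)$ the maximal number of pairwise vertex-disjoint directed cycles in $G$. For $v\in V(G)$ let $x_1,\dots,x_m$ be the edges with initial vertex $v$ and $y_1,\dots,y_n$ the edges with terminal vertex $v$, and let $e_l$ denote the $l$-th elementary symmetric polynomial ($e_l=0$ when $l$ exceeds the number of variables). Let $I(G)\subset\mathbb{Z}[E(G)]$ be the ideal generated by all $e_l(x_1,\dots,x_m)-e_l(y_1,\dots,y_n)$ with $v\in V(G)$ and $1\le l\le\max\{m,n\}$, and let $\tilde I(G)\subset\mathbb{Z}[E(G)]$ be the ideal generated by all $e_1(x_1,\dots,x_m)-e_1(y_1,\dots,y_n)$, all $e_l(x_1,\dots,x_m)$ with $2\le l\le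 m$, and all $e_l(y_1,\dots,y_n)$ with $2\le l\le n$, for $v\in V(G)$. Let $P(G)$ and $\tilde P(G)$ be the zero loci in $\mathbb{CP}^{|E(G)|-1}$ of the homogeneous ideals $I(G)$ and $\tilde I(G)$. A projective variety is a projective algebraic set that is not the union of two projective algebraic sets both different from it; with this convention the empty set is a projective variety, and it is also counted as a linear subspace (of dimension $-1$). Then: 1. The following are equivalent: (a) $P(G)$ is a projective variety; (b) $P(G)$ is a linear subspace of $\mathbb{CP}^{|E(G)|-1}$; (c) $G$ contains exactly $\alpha(G)$ distinct directed cycles. 2. The following are equivalent: (a) $\tilde P(G)$ is a projective variety; (b) $\tilde P(G)$ is a linear subspace of $\mathbb{CP}^{|E(G)|-1}$; (c) $G$ contains exactly $\tilde\alpha(G)$ distinct directed cycles. 3. If $\tilde P(G)$ is a projective variety, then $P(G)=\tilde P(G)$. -/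

import Mathlib

open scoped LinearAlgebra.Projectivization

/-- A directed graph with vertex set `V` and edge set `E`; loops and multiple edges are allowed. -/
structure DiMultigraph (V E : Type*) where
  /-- initial vertex of an edge -/
  src : E → V
  /-- terminal vertex of an edge -/
  tgt : E → V

/-! ### Projective algebraic sets in complex projective space with coordinates indexed by `E` -/

/-- The points of projective space at which all polynomials in `S` vanish, where a polynomial
vanishes at a point if it vanishes at every nonzero vector representing that point. -/
def projZeroLocus {E R : Type*} [CommRing R] [Algebra R ℂ] (S : Set (MvPolynomial E R)) :
    Set (ℙ ℂ (E → ℂ)) :=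
  {p | ∀ f ∈ S, ∀ (w : E → ℂ) (hw : w ≠ 0),
    Projectivization.mk ℂ w hw = p → MvPolynomial.aeval w f = 0}

/-- A projective algebraic set: the zero locus of a set of homogeneous complex polynomials. -/
def IsProjAlgebraicSet {E : Type*} (Z : Set (ℙ ℂ (E → ℂ))) : Prop :=
  ∃ S : Set (MvPolynomial E ℂ), (∀ f ∈ S, ∃ d : ℕ, f.IsHomogeneous d) ∧ Z = projZeroLocus S

/-- A projective variety: an irreducible projective algebraic set, i.e. one that is not the union
of two projective algebraic sets both different from it. (The empty set counts as irreducible.) -/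
def IsProjVariety {E : Type*} (Z : Set (ℙ ℂ (E → ℂ))) : Prop :=
  IsProjAlgebraicSet Z ∧
    ∀ Z₁ Z₂ : Set (ℙ ℂ (E → ℂ)), IsProjAlgebraicSet Z₁ → IsProjAlgebraicSet Z₂ →
      Z = Z₁ ∪ Z₂ → Z = Z₁ ∨ Z = Z₂

/-- A linear subspace of projective space (the empty set is the one of dimension `-1`). -/
def IsProjLinearSubspace {E : Type*} (Z : Set (ℙ ℂ (E → ℂ))) : Prop :=
  ∃ W : Projectivization.Subspace ℂ (E → ℂ), (W : Set (ℙ ℂ (E → ℂ))) = Z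

namespace DiMultigraph

variable {V E : Type*}

/-! ### Directed cycles -/

/-- A directed cycle `v₀, x₀, v₁, x₁, …, vₙ, xₙ, v₀`, recorded by its edges `x₀, …, xₙ` up to
circular permutation (`vᵢ` is the initial vertex of `xᵢ`): there is at least one edge, the terminal
vertex of each edge is the initial vertex of the cyclically next one, and `v₀, …, vₙ` are
pairwise distinct. -/
def IsDirectedCycle (G : DiMultigraph V E) (c : Cycle E) : Prop :=
  c ≠ Cycle.nil ∧ c.Chain (fun x y => G.tgt x = G.src y) ∧ (c.map G.src).Nodup

/-- The set of all directed cycles of `G`. -/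
def directedCycles (G : DiMultigraph V E) : Set (Cycle E) := {c | G.IsDirectedCycle c}

/-- No common edges. -/
def EdgeDisjoint (c d : Cycle E) : Prop := ∀ x, x ∈ c → x ∉ d

/-- No common vertices. -/
def VertexDisjoint (G : DiMultigraph V E) (c d : Cycle E) : Prop :=
  ∀ v, v ∈ c.map G.src → v ∉ d.map G.src

/-- The numbers of cycles in collections of pairwise edge-disjoint directed cycles. -/
def edgePackingSizes (G : DiMultigraph V E) : Set ℕ :=
  {n | ∃ C : Finset (Cycle E), (∀ c ∈ C, G.IsDirectedCycle c) ∧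
    (C : Set (Cycle E)).Pairwise EdgeDisjoint ∧ C.card = n}

/-- The numbers of cycles in collections of pairwise (vertex-)disjoint directed cycles. -/
def vertexPackingSizes (G : DiMultigraph V E) : Set ℕ :=
  {n | ∃ C : Finset (Cycle E), (∀ c ∈ C, G.IsDirectedCycle c) ∧
    (C : Set (Cycle E)).Pairwise G.VertexDisjoint ∧ C.card = n}

/-- The cycle packing number `α(G)`. -/
noncomputable def alpha (G : DiMultigraph V E) : ℕ := sSup G.edgePackingSizes

/-- The strong cycle packing number `α̃(G)`. -/
noncomputable def strongAlpha (G : DiMultigraph V E) : ℕ := sSup G.vertexPackingSizes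

theorem finite_directedCycles [Finite E] (G : DiMultigraph V E) : G.directedCycles.Finite := by
  classical
  have := Fintype.ofFinite E
  have hfin : {c : Cycle E | c.Nodup}.Finite :=
    Set.finite_coe_iff.mp (inferInstanceAs (Finite {c : Cycle E // c.Nodup}))
  refine hfin.subset ?_
  rintro c ⟨-, -, h⟩
  induction c using Quotient.inductionOn with
  | h l => exact List.Nodup.of_map G.src h

/-- `α(G)` is attained and is the maximum. -/
theorem isGreatest_alpha [Finite E] (G : DiMultigraph V E) :
    IsGreatest G.edgePackingSizes G.alpha := by
  have hb : BddAbove G.edgePackingSizes := by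
    refine ⟨G.directedCycles.ncard, ?_⟩
    rintro n ⟨C, hC, -, rfl⟩
    rw [← Set.ncard_coe_finset]
    exact Set.ncard_le_ncard hC G.finite_directedCycles
  exact ⟨Nat.sSup_mem ⟨0, ∅, by simp⟩ hb, fun n hn => le_csSup hb hn⟩

/-- `α̃(G)` is attained and is the maximum. -/
theorem isGreatest_strongAlpha [Finite E] (G : DiMultigraph V E) :
    IsGreatest G.vertexPackingSizes G.strongAlpha := by
  have hb : BddAbove G.vertexPackingSizes := by
    refine ⟨G.directedCycles.ncard, ?_⟩
    rintro n ⟨C, hC, -, rfl⟩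
    rw [← Set.ncard_coe_finset]
    exact Set.ncard_le_ncard hC G.finite_directedCycles
  exact ⟨Nat.sSup_mem ⟨0, ∅, by simp⟩ hb, fun n hn => le_csSup hb hn⟩

/-! ### Incidence ideals and incidence sets -/

section Incidence

variable [Fintype E]

open Classical in
/-- The edges having `v` as their initial vertex. -/
noncomputable def outEdges (G : DiMultigraph V E) (v : V) : Finset E :=
  Finset.univ.filter (fun x => G.src x = v)

open Classical in
/-- The edges having `v` as their terminal vertex. -/
noncomputable def inEdges (G : DiMultigraph V E) (v : V) : Finset E :=
  Finset.univ.filter (fun x => G.tgt x = v)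

/-- The `l`-th elementary symmetric polynomial in the variables belonging to the edges in `A`. -/
noncomputable def edgeESymm (A : Finset E) (l : ℕ) : MvPolynomial E ℤ :=
  (A.val.map (MvPolynomial.X : E → MvPolynomial E ℤ)).esymm l

/-- The incidence ideal `I(G)`. -/
noncomputable def incidenceIdeal (G : DiMultigraph V E) : Ideal (MvPolynomial E ℤ) :=
  Ideal.span {f | ∃ (v : V) (l : ℕ), 1 ≤ l ∧ l ≤ max (G.outEdges v).card (G.inEdges v).card ∧
    f = edgeESymm (G.outEdges v) l - edgeESymm (G.inEdges v) l}

/-- The strong incidence ideal. -/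
noncomputable def strongIncidenceIdeal (G : DiMultigraph V E) : Ideal (MvPolynomial E ℤ) :=
  Ideal.span
    ({f | ∃ v : V, f = edgeESymm (G.outEdges v) 1 - edgeESymm (G.inEdges v) 1} ∪
     {f | ∃ (v : V) (l : ℕ), 2 ≤ l ∧ l ≤ (G.outEdges v).card ∧ f = edgeESymm (G.outEdges v) l} ∪
     {f | ∃ (v : V) (l : ℕ), 2 ≤ l ∧ l ≤ (G.inEdges v).card ∧ f = edgeESymm (G.inEdges v) l})

/-- The incidence set `P(G)`. -/
def incidenceSet (G : DiMultigraph V E) : Set (ℙ ℂ (E → ℂ)) :=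
  projZeroLocus (G.incidenceIdeal : Set (MvPolynomial E ℤ))

/-- The strong incidence set `P̃(G)`. -/
def strongIncidenceSet (G : DiMultigraph V E) : Set (ℙ ℂ (E → ℂ)) :=
  projZeroLocus (G.strongIncidenceIdeal : Set (MvPolynomial E ℤ))

end Incidence

end DiMultigraph

/-!
Vieta's formulas, together with the vanishing of elementary symmetric polynomials in degrees above
the number of nonzero variables, turn the equations of `P(G)` into the condition that at each vertex
the nonzero labels of the outgoing edges and of the incoming edges are the same multiset. Then for
each `a ≠ 0` the edges labelled `a` have equal in- and out-degrees everywhere, hence decompose into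
edge-disjoint cycles. So `P(G)` is the union of the finitely many linear subspaces spanned by the
indicator vectors of edge-disjoint packings of cycles. For `P̃(G)` each vertex moreover has at most
one outgoing edge with a nonzero label, and the packings become vertex-disjoint.

If such a union is irreducible, then it is the span of a single packing `C`. The indicator vector of
every cycle `c` lies in this span. An element of the span is constant along each cycle of `C`, so
`c` contains a cycle of `C`, hence equals it. Thus all cycles form a packing; conversely, in this
case the union is the span of all cycles. For `P̃(G)` this packing of all cycles is vertex-disjoint,
hence edge-disjoint, and both loci are the same span.
-/

section ProjectiveAlgebraicSets

open MvPolynomial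

variable {E : Type*}

theorem aeval_smul_of_isHomogeneous {R A : Type*} [CommSemiring R] [CommSemiring A] [Algebra R A]
    {f : MvPolynomial E R} {d : ℕ} (hf : f.IsHomogeneous d) (a : A) (w : E → A) :
    aeval (a • w) f = a ^ d * aeval w f := by
  rw [aeval_def, aeval_def, eval₂_eq, eval₂_eq, Finset.mul_sum]
  refine Finset.sum_congr rfl fun s hs => ?_
  have hd : ∑ i ∈ s.support, s i = d := (hf.degree_eq_sum_deg_support hs).symm
  simp only [Pi.smul_apply, smul_eq_mul, mul_pow, Finset.prod_mul_distrib,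
    Finset.prod_pow_eq_pow_sum, hd]
  ring

theorem exists_mem_aeval_mul_ne_zero {R : Type*} [CommRing R] [IsDomain R] [Infinite R]
    {W : Submodule R (E → R)} {u v : E → R} (hu : u ∈ W) (hv : v ∈ W) {f g : MvPolynomial E R}
    (hf : aeval u f ≠ 0) (hg : aeval v g ≠ 0) : ∃ w ∈ W, aeval w (f * g) ≠ 0 := by
  let line : E → Polynomial R := fun i =>
    Polynomial.C (u i) + Polynomial.X * Polynomial.C (v i - u i)
  have eval_line (t : R) (h : MvPolynomial E R) :
      (aeval line h).eval t = aeval (u + t • (v - u)) h := by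
    rw [← Polynomial.coe_aeval_eq_eval, ← AlgHom.comp_apply, comp_aeval]
    congr 2
    ext i
    simp [line]
  have hf' : aeval line f ≠ 0 := fun h => hf (by simpa [h] using (eval_line 0 f).symm)
  have hg' : aeval line g ≠ 0 := fun h => hg (by simpa [h] using (eval_line 1 g).symm)
  obtain ⟨t, ht⟩ : ∃ t, (aeval line (f * g)).eval t ≠ 0 := by
    by_contra! h
    exact mul_ne_zero hf' hg' (by rw [← map_mul]; exact Polynomial.funext (by simpa using h))
  exact ⟨_, W.add_mem hu (W.smul_mem t (W.sub_mem hv hu)), eval_line t _ ▸ ht⟩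

theorem mk_mem_projZeroLocus_iff {R : Type*} [CommRing R] [Algebra R ℂ]
    {S : Set (MvPolynomial E R)} (hS : ∀ f ∈ S, ∃ d : ℕ, f.IsHomogeneous d) {w : E → ℂ}
    (hw : w ≠ 0) :
    Projectivization.mk ℂ w hw ∈ projZeroLocus S ↔ ∀ f ∈ S, aeval w f = 0 := by
  refine ⟨fun h f hf => h f hf w hw rfl, fun h f hf u hu e => ?_⟩
  obtain ⟨a, rfl⟩ := (Projectivization.mk_eq_mk_iff' ℂ _ _ hu hw).1 e
  obtain ⟨d, hd⟩ := hS f hf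
  rw [aeval_smul_of_isHomogeneous hd, h f hf, mul_zero]

theorem projZeroLocus_span {R : Type*} [CommRing R] [Algebra R ℂ] (S : Set (MvPolynomial E R)) :
    projZeroLocus (Ideal.span S : Set (MvPolynomial E R)) = projZeroLocus S := by
  refine Set.Subset.antisymm (fun p hp f hf => hp f (Ideal.subset_span hf)) ?_
  intro p hp f hf w hw e
  have hle : Ideal.span S ≤ RingHom.ker (aeval w : MvPolynomial E R →ₐ[R] ℂ) :=
    Ideal.span_le.2 fun g hg => hp g hg w hw e
  exact hle hf

theorem isProjAlgebraicSet_empty : IsProjAlgebraicSet (∅ : Set (ℙ ℂ (E → ℂ))) := by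
  refine ⟨{1}, fun f hf => ⟨0, hf ▸ isHomogeneous_one E ℂ⟩, ?_⟩
  refine (Set.eq_empty_of_forall_notMem (Projectivization.ind fun w hw h => ?_)).symm
  simpa using h 1 rfl w hw rfl

theorem IsProjAlgebraicSet.union {Z₁ Z₂ : Set (ℙ ℂ (E → ℂ))} (h₁ : IsProjAlgebraicSet Z₁)
    (h₂ : IsProjAlgebraicSet Z₂) : IsProjAlgebraicSet (Z₁ ∪ Z₂) := by
  obtain ⟨S, hS, rfl⟩ := h₁
  obtain ⟨T, hT, rfl⟩ := h₂
  have hST : ∀ f ∈ Set.image2 (· * ·) S T, ∃ d : ℕ, f.IsHomogeneous d := by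
    rintro _ ⟨f, hf, g, hg, rfl⟩
    obtain ⟨d, hd⟩ := hS f hf
    obtain ⟨e, he⟩ := hT g hg
    exact ⟨d + e, hd.mul he⟩
  refine ⟨_, hST, ?_⟩
  ext p
  induction p using Projectivization.ind with | h w hw
  rw [Set.mem_union, mk_mem_projZeroLocus_iff hS, mk_mem_projZeroLocus_iff hT,
    mk_mem_projZeroLocus_iff hST, Set.forall_mem_image2]
  simp only [map_mul, mul_eq_zero]
  grind

theorem isProjAlgebraicSet_sUnion {𝒴 : Set (Set (ℙ ℂ (E → ℂ)))} (h𝒴 : 𝒴.Finite)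
    (h : ∀ Y ∈ 𝒴, IsProjAlgebraicSet Y) : IsProjAlgebraicSet (⋃₀ 𝒴) := by
  induction 𝒴, h𝒴 using Set.Finite.induction_on with
  | empty => simpa using isProjAlgebraicSet_empty
  | insert _ _ ih =>
    rw [Set.sUnion_insert]
    rw [Set.forall_mem_insert] at h
    exact h.1.union (ih h.2)

theorem IsProjVariety.mem_of_eq_sUnion {Z : Set (ℙ ℂ (E → ℂ))} (hZ : IsProjVariety Z)
    {𝒴 : Set (Set (ℙ ℂ (E → ℂ)))} (h𝒴 : 𝒴.Finite) (hne : 𝒴.Nonempty)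
    (h : ∀ Y ∈ 𝒴, IsProjAlgebraicSet Y) (hZ𝒴 : Z = ⋃₀ 𝒴) : Z ∈ 𝒴 := by
  induction 𝒴, h𝒴 using Set.Finite.induction_on with
  | empty => exact absurd hne Set.not_nonempty_empty
  | @insert Y 𝒴 _ h𝒴 ih =>
    rw [Set.forall_mem_insert] at h
    rw [Set.sUnion_insert] at hZ𝒴
    rcases 𝒴.eq_empty_or_nonempty with rfl | hne
    · simpa using hZ𝒴
    rcases hZ.2 _ _ h.1 (isProjAlgebraicSet_sUnion h𝒴 h.2) hZ𝒴 with rfl | hZ𝒴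
    · exact Set.mem_insert _ _
    · exact Set.mem_insert_of_mem _ (ih hne h.2 hZ𝒴)

theorem isProjAlgebraicSet_projectivization [Finite E] (W : Submodule ℂ (E → ℂ)) :
    IsProjAlgebraicSet (W.projectivization : Set (ℙ ℂ (E → ℂ))) := by
  classical
  have := Fintype.ofFinite E
  let b := Module.finBasis ℂ ((E → ℂ) ⧸ W)
  let equation := W.mkQ.toMvPolynomial (Pi.basisFun ℂ E) b
  have aeval_equation (w : E → ℂ) (i) : aeval w (equation i) = b.repr (W.mkQ w) i := by
    have h := W.mkQ.toMvPolynomial_eval_eq_apply (Pi.basisFun ℂ E) b i ((Pi.basisFun ℂ E).repr w)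
    rwa [LinearEquiv.symm_apply_apply] at h
  have homogeneous : ∀ f ∈ Set.range equation, ∃ d : ℕ, f.IsHomogeneous d := by
    rintro _ ⟨i, rfl⟩
    exact ⟨1, W.mkQ.toMvPolynomial_isHomogeneous _ _ i⟩
  refine ⟨_, homogeneous, ?_⟩
  ext p
  induction p using Projectivization.ind with | h w hw
  rw [mk_mem_projZeroLocus_iff homogeneous, SetLike.mem_coe, Submodule.mk_mem_projectivization_iff,
    Set.forall_mem_range, ← Submodule.Quotient.mk_eq_zero, b.ext_elem_iff]
  simp only [aeval_equation, Submodule.mkQ_apply, map_zero, Finsupp.zero_apply]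

theorem IsProjAlgebraicSet.exists_aeval_ne_zero {Z : Set (ℙ ℂ (E → ℂ))}
    (hZ : IsProjAlgebraicSet Z) {w : E → ℂ} {hw : w ≠ 0} (h : Projectivization.mk ℂ w hw ∉ Z) :
    ∃ f : MvPolynomial E ℂ, aeval w f ≠ 0 ∧
      ∀ u hu, Projectivization.mk ℂ u hu ∈ Z → aeval u f = 0 := by
  obtain ⟨S, hS, rfl⟩ := hZ
  rw [mk_mem_projZeroLocus_iff hS] at h
  push Not at h
  obtain ⟨f, hf, hfw⟩ := h
  exact ⟨f, hfw, fun u hu h => h f hf u hu rfl⟩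

theorem isProjVariety_projectivization [Finite E] (W : Submodule ℂ (E → ℂ)) :
    IsProjVariety (W.projectivization : Set (ℙ ℂ (E → ℂ))) := by
  refine ⟨isProjAlgebraicSet_projectivization W, fun Z₁ Z₂ h₁ h₂ h => ?_⟩
  by_contra! hne
  obtain ⟨p, hpW, hp⟩ := Set.not_subset.1 fun hle =>
    hne.1 (hle.antisymm (h ▸ Set.subset_union_left))
  obtain ⟨q, hqW, hq⟩ := Set.not_subset.1 fun hle =>
    hne.2 (hle.antisymm (h ▸ Set.subset_union_right))
  induction p using Projectivization.ind with | h u hu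
  induction q using Projectivization.ind with | h v hv
  obtain ⟨f, hfu, hf⟩ := h₁.exists_aeval_ne_zero hp
  obtain ⟨g, hgv, hg⟩ := h₂.exists_aeval_ne_zero hq
  obtain ⟨i, hi⟩ := Function.ne_iff.1 hu
  -- The factor `X i` keeps the common nonvanishing point away from the origin.
  have hfX : aeval u (f * X i) ≠ 0 := by
    rw [map_mul, aeval_X]
    exact mul_ne_zero hfu hi
  obtain ⟨w, hwW, hw⟩ := exists_mem_aeval_mul_ne_zero hpW hqW hfX hgv
  simp only [map_mul, aeval_X, ne_eq, mul_eq_zero, not_or] at hw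
  have hw0 : w ≠ 0 := fun h0 => hw.1.2 (congrFun h0 i)
  have hwZ : Projectivization.mk ℂ w hw0 ∈ Z₁ ∪ Z₂ := h ▸ hwW
  exact hwZ.elim (fun hwZ => hw.1.1 (hf w hw0 hwZ)) fun hwZ => hw.2 (hg w hw0 hwZ)

theorem IsProjLinearSubspace.isProjVariety [Finite E] {Z : Set (ℙ ℂ (E → ℂ))}
    (hZ : IsProjLinearSubspace Z) : IsProjVariety Z := by
  obtain ⟨W, rfl⟩ := hZ
  simpa using isProjVariety_projectivization (Projectivization.Subspace.submodule W)

end ProjectiveAlgebraicSets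

section ElementarySymmetricFunctions

open Multiset

theorem esymm_eq_zero_of_card_lt {R : Type*} [CommSemiring R] {s : Multiset R} {n : ℕ}
    (h : card s < n) : s.esymm n = 0 := by
  simp [esymm, powersetCard_eq_empty n h]

theorem esymm_filter_ne_zero {R : Type*} [CommSemiring R] [DecidableEq R] (s : Multiset R)
    (n : ℕ) : (s.filter (· ≠ 0)).esymm n = s.esymm n := by
  have esymm_zero_add (k : ℕ) (t : Multiset R) : (replicate k 0 + t).esymm n = t.esymm n := by
    induction k with
    | zero => simp
    | succ k ih =>
      rw [replicate_succ, cons_add, ← ih]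
      cases n <;> simp [esymm, powersetCard_cons]
  have hzero : s.filter (¬ · ≠ 0) = replicate (s.count 0) 0 := by
    simp only [not_not, filter_eq']
  rw [← esymm_zero_add (s.count 0), ← hzero, add_comm, filter_add_not]

variable {R : Type*} [CommRing R] [IsDomain R]

theorem eq_of_card_eq_of_esymm_eq {s t : Multiset R} (hcard : card s = card t)
    (h : ∀ n, s.esymm n = t.esymm n) : s = t := by
  have hprod : (s.map fun a => Polynomial.X - Polynomial.C a).prod =
      (t.map fun a => Polynomial.X - Polynomial.C a).prod := by
    simp only [prod_X_sub_X_eq_sum_esymm, hcard, h]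
  rw [← Polynomial.roots_multiset_prod_X_sub_C s, hprod, Polynomial.roots_multiset_prod_X_sub_C]

variable [DecidableEq R]

theorem card_filter_ne_zero_le_iff_esymm_eq_zero {s : Multiset R} {k : ℕ} :
    card (s.filter (· ≠ 0)) ≤ k ↔ ∀ n > k, s.esymm n = 0 := by
  refine ⟨fun h n hn => ?_, fun h => ?_⟩
  · rw [← esymm_filter_ne_zero, esymm_eq_zero_of_card_lt (h.trans_lt hn)]
  · by_contra! hk
    have htop := h _ hk
    rw [← esymm_filter_ne_zero, esymm, powersetCard_self, map_singleton, sum_singleton,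
      prod_eq_zero_iff] at htop
    simp at htop

theorem filter_ne_zero_eq_iff_esymm_eq {s t : Multiset R} :
    s.filter (· ≠ 0) = t.filter (· ≠ 0) ↔ ∀ n, s.esymm n = t.esymm n := by
  refine ⟨fun h n => ?_, fun h => ?_⟩
  · rw [← esymm_filter_ne_zero s, h, esymm_filter_ne_zero]
  · refine eq_of_card_eq_of_esymm_eq (eq_of_forall_ge_iff fun k => ?_) fun n => ?_
    · simp only [card_filter_ne_zero_le_iff_esymm_eq_zero, h]
    · rw [esymm_filter_ne_zero, esymm_filter_ne_zero, h]

end ElementarySymmetricFunctions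

theorem encard_eq_iff_pairwise_of_isGreatest {α : Type*} {R : α → α → Prop} {D : Set α}
    (hD : D.Finite) {n : ℕ} (hn : IsGreatest {m | ∃ C : Finset α, (∀ c ∈ C, c ∈ D) ∧
      (C : Set α).Pairwise R ∧ C.card = m} n) : D.encard = n ↔ D.Pairwise R := by
  lift D to Finset α using hD
  rw [Set.encard_coe_eq_coe_finsetCard, Nat.cast_inj]
  obtain ⟨⟨C, hC, hCR, rfl⟩, hmax⟩ := hn
  constructor
  · intro hcard
    rwa [← Finset.eq_of_subset_of_card_le hC hcard.le]
  · exact fun h => (hmax ⟨D, fun _ => id, h, rfl⟩).antisymm (Finset.card_le_card hC)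

namespace DiMultigraph

section DirectedCycles

variable {α : Type*}

theorem exists_mem_of_ne_nil {c : Cycle α} (hc : c ≠ Cycle.nil) : ∃ x, x ∈ c := by
  induction c using Cycle.induction_on with
  | nil => exact absurd rfl hc
  | cons x l _ => exact ⟨x, by simp⟩

theorem exists_eq_coe_cons_of_mem {c : Cycle α} {x : α} (hx : x ∈ c) :
    ∃ l : List α, c = (x :: l : List α) := by
  induction c using Quotient.inductionOn' with | h l
  obtain ⟨s, t, rfl⟩ := List.append_of_mem hx
  exact ⟨t ++ s, Cycle.coe_eq_coe.2 List.isRotated_append⟩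

theorem chain_and_mem_of_chain {r : α → α → Prop} {c : Cycle α} (hc : c.Chain r) :
    c.Chain fun a b => b ∈ c ∧ r a b := by
  induction c using Cycle.induction_on with
  | nil => trivial
  | cons x l _ =>
    rw [Cycle.chain_coe_cons] at hc ⊢
    refine hc.imp_of_mem_tail_imp fun a b _ hb hab => ⟨?_, hab⟩
    simpa [or_comm] using hb

theorem eq_of_isChain_cons_append_singleton {r : α → α → Prop} (hr : Relator.RightUnique r)
    {a x : α} {l₁ l₂ : List α} (h₁ : List.IsChain r (a :: (l₁ ++ [x])))
    (h₂ : List.IsChain r (a :: (l₂ ++ [x]))) (hx₁ : x ∉ l₁) (hx₂ : x ∉ l₂) : l₁ = l₂ := by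
  induction l₁ generalizing a l₂ with
  | nil =>
    cases l₂ with
    | nil => rfl
    | cons b l₂ =>
      simp only [List.nil_append, List.cons_append, List.isChain_cons_cons] at h₁ h₂
      exact absurd (hr h₁.1 h₂.1) (List.ne_of_not_mem_cons hx₂)
  | cons b l₁ ih =>
    cases l₂ with
    | nil =>
      simp only [List.nil_append, List.cons_append, List.isChain_cons_cons] at h₁ h₂
      exact absurd (hr h₂.1 h₁.1) (List.ne_of_not_mem_cons hx₁)
    | cons b' l₂ =>
      simp only [List.cons_append, List.isChain_cons_cons] at h₁ h₂
      obtain rfl := hr h₁.1 h₂.1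
      rw [ih h₁.2 h₂.2 (List.not_mem_of_not_mem_cons hx₁) (List.not_mem_of_not_mem_cons hx₂)]

theorem cycle_eq_of_chain_of_mem {r : α → α → Prop} (hr : Relator.RightUnique r) {c d : Cycle α}
    (hc : c.Nodup) (hd : d.Nodup) (hcr : c.Chain r) (hdr : d.Chain r) {x : α} (hxc : x ∈ c)
    (hxd : x ∈ d) : c = d := by
  obtain ⟨l₁, rfl⟩ := exists_eq_coe_cons_of_mem hxc
  obtain ⟨l₂, rfl⟩ := exists_eq_coe_cons_of_mem hxd
  rw [Cycle.nodup_coe_iff, List.nodup_cons] at hc hd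
  rw [Cycle.chain_coe_cons] at hcr hdr
  rw [eq_of_isChain_cons_append_singleton hr hcr hdr hc.1 hd.1]

theorem exists_mem_periodicPts [Finite α] [Nonempty α] (f : α → α) :
    ∃ x, x ∈ Function.periodicPts f := by
  obtain ⟨x⟩ := ‹Nonempty α›
  obtain ⟨m, n, hlt, h⟩ := Set.finite_univ.exists_lt_map_eq_of_forall_mem
    (f := fun n : ℕ => f^[n] x) fun _ => Set.mem_univ _
  refine ⟨f^[m] x, Function.mk_mem_periodicPts (Nat.sub_pos_of_lt hlt) ?_⟩
  rw [Function.IsPeriodicPt, Function.IsFixedPt, ← Function.iterate_add_apply,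
    Nat.sub_add_cancel hlt.le]
  exact h.symm

variable {V E : Type*} {G : DiMultigraph V E} {c d : Cycle E}

theorem IsDirectedCycle.nodup (hc : G.IsDirectedCycle c) : c.Nodup := by
  induction c using Quotient.inductionOn' with | h l
  exact List.Nodup.of_map G.src hc.2.2

theorem IsDirectedCycle.src_injOn (hc : G.IsDirectedCycle c) : Set.InjOn G.src {x | x ∈ c} := by
  induction c using Quotient.inductionOn' with | h l
  exact fun x hx y hy => List.inj_on_of_nodup_map hc.2.2 hx hy

theorem IsDirectedCycle.eq_of_subset (hc : G.IsDirectedCycle c) (hd : G.IsDirectedCycle d)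
    (h : ∀ x ∈ c, x ∈ d) : c = d := by
  obtain ⟨x, hx⟩ := exists_mem_of_ne_nil hc.1
  refine cycle_eq_of_chain_of_mem (r := fun a b => b ∈ d ∧ G.tgt a = G.src b) ?_ hc.nodup hd.nodup
    ?_ (chain_and_mem_of_chain hd.2.1) hx (h x hx)
  · exact fun a b b' hb hb' => hd.src_injOn hb.1 hb'.1 (hb.2.symm.trans hb'.2)
  · exact (chain_and_mem_of_chain hc.2.1).imp fun a b hab => ⟨h b hab.1, hab.2⟩

theorem IsDirectedCycle.map_src_toMultiset_eq (hc : G.IsDirectedCycle c) :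
    c.toMultiset.map G.src = c.toMultiset.map G.tgt := by
  obtain ⟨x, hx⟩ := exists_mem_of_ne_nil hc.1
  obtain ⟨l, rfl⟩ := exists_eq_coe_cons_of_mem hx
  have htgt : (x :: l).map G.tgt = (l ++ [x]).map G.src := by
    rw [← List.forall₂_eq_eq_eq, List.forall₂_map_left_iff, List.forall₂_map_right_iff]
    exact List.isChain_cons_append_singleton_iff_forall₂.1 ((Cycle.chain_coe_cons _ _ _).1 hc.2.1)
  rw [Cycle.coe_toMultiset, Multiset.map_coe, Multiset.map_coe, htgt, Multiset.coe_eq_coe]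
  exact (List.perm_append_singleton x l).symm.map _

theorem isDirectedCycle_periodicOrbit_map {e : α → E} {f : α → α}
    (hf : ∀ a, G.tgt (e a) = G.src (e (f a))) (he : Function.Injective fun a => G.src (e a)) {a : α}
    (ha : a ∈ Function.periodicPts f) :
    G.IsDirectedCycle ((Function.periodicOrbit f a).map e) := by
  refine ⟨?_, ?_, ?_⟩
  · rw [Ne, Cycle.map_eq_nil, Function.periodicOrbit_eq_nil_iff_not_periodic_pt, not_not]
    exact ha
  · rw [Cycle.chain_map, Function.periodicOrbit_chain' _ ha]
    intro n
    rw [Function.iterate_succ_apply', hf]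
  · have hnodup := Function.nodup_periodicOrbit (f := f) (x := a)
    generalize Function.periodicOrbit f a = orbit at hnodup ⊢
    induction orbit using Quotient.inductionOn' with | h l
    rw [Cycle.mk''_eq_coe, Cycle.nodup_coe_iff] at hnodup
    rw [Cycle.mk''_eq_coe, Cycle.map_coe, Cycle.map_coe, Cycle.nodup_coe_iff, List.map_map]
    exact hnodup.map he

theorem exists_isDirectedCycle_of_forall_exists {A : Set E} (hfin : A.Finite) (hA : A.Nonempty)
    (h : ∀ x ∈ A, ∃ y ∈ A, G.tgt x = G.src y) : ∃ c, G.IsDirectedCycle c ∧ ∀ x ∈ c, x ∈ A := by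
  have := (hfin.image G.src).to_subtype
  have := (hA.image G.src).to_subtype
  choose e heA hsrc using fun v : G.src '' A => v.2
  choose next hnextA hnext using fun v : G.src '' A => h (e v) (heA v)
  let f (v : G.src '' A) : G.src '' A := ⟨G.src (next v), next v, hnextA v, rfl⟩
  obtain ⟨v, hv⟩ := exists_mem_periodicPts f
  refine ⟨(Function.periodicOrbit f v).map e, isDirectedCycle_periodicOrbit_map ?_ ?_ hv, ?_⟩
  · intro u
    rw [hnext, hsrc]
  · simpa only [hsrc] using Subtype.val_injective
  · intro x hx
    obtain ⟨u, -, rfl⟩ := Cycle.mem_map.1 hx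
    exact heA u

end DirectedCycles

section EulerianSets

variable {V E : Type*} {G : DiMultigraph V E}

/-- A finite set of edges is Eulerian if every vertex is the initial vertex of as many of its edges
as it is the terminal vertex of. -/
def IsEulerian (G : DiMultigraph V E) (A : Finset E) : Prop :=
  A.val.map G.src = A.val.map G.tgt

/-- A set of directed cycles that are pairwise related by `R`, which is to be edge-disjointness or
vertex-disjointness. -/
def IsPacking (G : DiMultigraph V E) (R : Cycle E → Cycle E → Prop) (C : Set (Cycle E)) : Prop :=
  C ⊆ G.directedCycles ∧ C.Pairwise R

instance : Std.Symm (EdgeDisjoint (E := E)) where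
  symm _ _ h x hd hc := h x hc hd

theorem VertexDisjoint.edgeDisjoint {c d : Cycle E} (h : G.VertexDisjoint c d) :
    EdgeDisjoint c d := fun x hc hd =>
  h (G.src x) (Cycle.mem_map.2 ⟨x, hc, rfl⟩) (Cycle.mem_map.2 ⟨x, hd, rfl⟩)

variable {A B : Finset E} {c : Cycle E}

theorem mem_toFinset_cycle [DecidableEq E] {x : E} : x ∈ c.toFinset ↔ x ∈ c := by
  induction c using Quotient.inductionOn' with | h l
  exact List.mem_toFinset

theorem IsDirectedCycle.isEulerian_toFinset [DecidableEq E] (hc : G.IsDirectedCycle c) :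
    G.IsEulerian c.toFinset := by
  have hval : c.toFinset.val = c.toMultiset := by
    have hnodup := hc.nodup
    induction c using Quotient.inductionOn' with | h l
    exact congrArg _ (List.dedup_eq_self.2 hnodup)
  rw [IsEulerian, hval, hc.map_src_toMultiset_eq]

theorem IsEulerian.sdiff [DecidableEq E] (hA : G.IsEulerian A) (hB : G.IsEulerian B)
    (h : B ⊆ A) : G.IsEulerian (A \ B) := by
  have hsplit : A.val = (A \ B).val + B.val := by
    rw [Finset.sdiff_val, tsub_add_cancel_of_le (Finset.val_le_iff.2 h)]
  rw [IsEulerian, hsplit, Multiset.map_add, Multiset.map_add, hB] at hA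
  exact add_right_cancel hA

theorem isEulerian_biUnion [DecidableEq E] {ι : Type*} {s : Finset ι} {f : ι → Finset E}
    (hf : ∀ i ∈ s, G.IsEulerian (f i)) (hdisj : (s : Set ι).PairwiseDisjoint f) :
    G.IsEulerian (s.biUnion f) := by
  rw [← Finset.disjiUnion_eq_biUnion s f hdisj, IsEulerian, Finset.disjiUnion_val,
    Multiset.map_bind, Multiset.map_bind]
  exact Multiset.bind_congr hf

theorem IsEulerian.exists_isDirectedCycle (hA : G.IsEulerian A) (hne : A.Nonempty) :
    ∃ c, G.IsDirectedCycle c ∧ ∀ x ∈ c, x ∈ A := by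
  refine exists_isDirectedCycle_of_forall_exists A.finite_toSet hne fun x hx => ?_
  have htgt : G.tgt x ∈ A.val.map G.src := hA ▸ Multiset.mem_map_of_mem _ hx
  obtain ⟨y, hy, hyx⟩ := Multiset.mem_map.1 htgt
  exact ⟨y, hy, hyx.symm⟩

theorem IsEulerian.exists_isPacking (hA : G.IsEulerian A) :
    ∃ C, G.IsPacking EdgeDisjoint C ∧ ∀ x, x ∈ A ↔ ∃ c ∈ C, x ∈ c := by
  classical
  induction A using Finset.strongInduction with | H A ih
  obtain rfl | hne := A.eq_empty_or_nonempty
  · exact ⟨∅, ⟨Set.empty_subset _, Set.pairwise_empty _⟩, by simp⟩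
  obtain ⟨c, hc, hcA⟩ := hA.exists_isDirectedCycle hne
  obtain ⟨x, hx⟩ := exists_mem_of_ne_nil hc.1
  have hsub : c.toFinset ⊆ A := fun y hy => hcA y (mem_toFinset_cycle.1 hy)
  have hssub : A \ c.toFinset ⊂ A :=
    Finset.sdiff_ssubset hsub ⟨x, mem_toFinset_cycle.2 hx⟩
  obtain ⟨C, ⟨hC, hdisj⟩, hcover⟩ := ih _ hssub (hA.sdiff hc.isEulerian_toFinset hsub)
  simp only [Finset.mem_sdiff, mem_toFinset_cycle] at hcover
  refine ⟨insert c C, ⟨Set.insert_subset hc hC, ?_⟩, fun y => ?_⟩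
  · refine hdisj.insert_of_symm fun d hd _ y hyc hyd => ?_
    exact ((hcover y).2 ⟨d, hd, hyd⟩).2 hyc
  · rw [Set.exists_mem_insert, ← hcover]
    have := hcA y
    tauto

theorem IsPacking.isEulerian [Finite E] {C : Set (Cycle E)} (hC : G.IsPacking EdgeDisjoint C)
    (hcover : ∀ x, x ∈ A ↔ ∃ c ∈ C, x ∈ c) : G.IsEulerian A := by
  classical
  obtain ⟨hC, hdisj⟩ := hC
  have hfin : C.Finite := G.finite_directedCycles.subset hC
  have hA : A = hfin.toFinset.biUnion Cycle.toFinset := by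
    ext x
    simp [hcover, mem_toFinset_cycle]
  rw [hA]
  refine isEulerian_biUnion (fun c hc => ?_) fun c hc d hd hcd => ?_
  · exact IsDirectedCycle.isEulerian_toFinset (hC (hfin.mem_toFinset.1 hc))
  · rw [hfin.coe_toFinset] at hc hd
    simp only [Function.onFun, Finset.disjoint_left, mem_toFinset_cycle]
    exact hdisj hc hd hcd

end EulerianSets

section CycleSpan

variable {V E : Type*} {G : DiMultigraph V E} {K : Type*} {C D : Set (Cycle E)}

/-- The indicator vector of the set of edges of a cycle. -/
noncomputable def cycleVec (K : Type*) [Zero K] [One K] (c : Cycle E) : E → K :=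
  Set.indicator {x | x ∈ c} 1

/-- The space of edge labellings spanned by the indicator vectors of the cycles in `C`. -/
noncomputable def cycleSpan (K : Type*) [Semiring K] (C : Set (Cycle E)) : Submodule K (E → K) :=
  Submodule.span K (cycleVec K '' C)

theorem cycleVec_apply_of_mem [Zero K] [One K] {c : Cycle E} {x : E} (hx : x ∈ c) :
    cycleVec K c x = 1 :=
  Set.indicator_of_mem (s := {x | x ∈ c}) hx 1

theorem cycleVec_apply_of_notMem [Zero K] [One K] {c : Cycle E} {x : E} (hx : x ∉ c) :
    cycleVec K c x = 0 :=
  Set.indicator_of_notMem (s := {x | x ∈ c}) hx 1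

variable [Semiring K] {w : E → K}

theorem cycleVec_mem_cycleSpan {c : Cycle E} (hc : c ∈ C) : cycleVec K c ∈ cycleSpan K C :=
  Submodule.subset_span (Set.mem_image_of_mem _ hc)

theorem cycleSpan_mono (h : C ⊆ D) : cycleSpan K C ≤ cycleSpan K D :=
  Submodule.span_mono (Set.image_mono h)

theorem exists_mem_of_mem_cycleSpan (hw : w ∈ cycleSpan K C) {x : E} (hx : w x ≠ 0) :
    ∃ c ∈ C, x ∈ c := by
  contrapose! hx
  induction hw using Submodule.span_induction with
  | mem _ h =>
    obtain ⟨c, hc, rfl⟩ := h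
    exact cycleVec_apply_of_notMem (hx c hc)
  | zero => rfl
  | add u v _ _ hu hv => rw [Pi.add_apply, hu, hv, add_zero]
  | smul a u _ hu => rw [Pi.smul_apply, hu, smul_zero]

theorem exists_forall_eq_of_mem_cycleSpan (hC : C.Pairwise EdgeDisjoint)
    (hw : w ∈ cycleSpan K C) {c : Cycle E} (hc : c ∈ C) : ∃ a, ∀ x ∈ c, w x = a := by
  induction hw using Submodule.span_induction with
  | mem _ h =>
    obtain ⟨d, hd, rfl⟩ := h
    obtain rfl | hcd := eq_or_ne c d
    · exact ⟨1, fun x hx => cycleVec_apply_of_mem hx⟩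
    · exact ⟨0, fun x hx => cycleVec_apply_of_notMem (hC hc hd hcd x hx)⟩
  | zero => exact ⟨0, fun x _ => rfl⟩
  | add u v _ _ hu hv =>
    obtain ⟨a, ha⟩ := hu
    obtain ⟨b, hb⟩ := hv
    exact ⟨a + b, fun x hx => by rw [Pi.add_apply, ha x hx, hb x hx]⟩
  | smul r u _ hu =>
    obtain ⟨a, ha⟩ := hu
    exact ⟨r • a, fun x hx => by rw [Pi.smul_apply, ha x hx]⟩

theorem mem_cycleSpan_of_forall_eq (hfin : C.Finite) (hC : C.Pairwise EdgeDisjoint)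
    (hconst : ∀ c ∈ C, ∃ a, ∀ x ∈ c, w x = a) (hsupp : ∀ x, w x ≠ 0 → ∃ c ∈ C, x ∈ c) :
    w ∈ cycleSpan K C := by
  choose! a ha using hconst
  have hw : w = ∑ c ∈ hfin.toFinset, a c • cycleVec K c := by
    ext x
    rw [Finset.sum_apply]
    by_cases hx : ∃ c ∈ C, x ∈ c
    · obtain ⟨c, hc, hxc⟩ := hx
      rw [Finset.sum_eq_single_of_mem c (hfin.mem_toFinset.2 hc)]
      · rw [Pi.smul_apply, cycleVec_apply_of_mem hxc, smul_eq_mul, mul_one, ha c hc x hxc]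
      · intro d hd hdc
        have hxd : x ∉ d := hC hc (hfin.mem_toFinset.1 hd) hdc.symm x hxc
        rw [Pi.smul_apply, cycleVec_apply_of_notMem hxd, smul_zero]
    · rw [not_imp_comm.1 (hsupp x) hx, Finset.sum_eq_zero]
      intro c hc
      have hxc : x ∉ c := fun hxc => hx ⟨c, hfin.mem_toFinset.1 hc, hxc⟩
      rw [Pi.smul_apply, cycleVec_apply_of_notMem hxc, smul_zero]
  rw [hw]
  exact Submodule.sum_mem _ fun c hc =>
    Submodule.smul_mem _ _ (cycleVec_mem_cycleSpan (hfin.mem_toFinset.1 hc))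

variable [Nontrivial K]

theorem IsDirectedCycle.cycleVec_ne_zero {c : Cycle E} (hc : G.IsDirectedCycle c) :
    cycleVec K c ≠ 0 := by
  obtain ⟨x, hx⟩ := exists_mem_of_ne_nil hc.1
  exact Function.ne_iff.2 ⟨x, by simp [cycleVec_apply_of_mem hx]⟩

theorem IsPacking.mem_of_cycleVec_mem_cycleSpan (hC : G.IsPacking EdgeDisjoint C) {c : Cycle E}
    (hc : G.IsDirectedCycle c) (h : cycleVec K c ∈ cycleSpan K C) : c ∈ C := by
  obtain ⟨x, hxc⟩ := exists_mem_of_ne_nil hc.1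
  have hx : cycleVec K c x ≠ 0 := by simp [cycleVec_apply_of_mem hxc]
  obtain ⟨d, hd, hxd⟩ := exists_mem_of_mem_cycleSpan h hx
  obtain ⟨a, ha⟩ := exists_forall_eq_of_mem_cycleSpan hC.2 h hd
  have hdc : d = c := (hC.1 hd).eq_of_subset hc fun y hyd => by
    by_contra hyc
    rw [ha x hxd, ← ha y hyd, cycleVec_apply_of_notMem hyc] at hx
    exact hx rfl
  exact hdc ▸ hd

end CycleSpan

section BalancedLabellings

variable {V E : Type*} [Fintype E] {G : DiMultigraph V E} {K : Type*}

open Classical in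
/-- An edge labelling is balanced if, for every `a ≠ 0`, the edges labelled `a` form an Eulerian
set; that is, the nonzero labels of the edges leaving a vertex are those of the edges entering it,
with multiplicities. -/
def IsBalanced [Zero K] (G : DiMultigraph V E) (w : E → K) : Prop :=
  ∀ a ≠ 0, G.IsEulerian (Finset.univ.filter fun x => w x = a)

/-- A balanced edge labelling in which every vertex is the initial vertex of at most one edge with a
nonzero label. -/
def IsStronglyBalanced [Zero K] (G : DiMultigraph V E) (w : E → K) : Prop :=
  G.IsBalanced w ∧ Set.InjOn G.src (Function.support w)

variable [Semiring K] {w : E → K} {C : Set (Cycle E)}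

theorem IsBalanced.exists_isPacking (hw : G.IsBalanced w) :
    ∃ C, G.IsPacking EdgeDisjoint C ∧ w ∈ cycleSpan K C ∧ ∀ c ∈ C, ∀ x ∈ c, w x ≠ 0 := by
  choose! C hC hcover using fun a (ha : a ≠ 0) => (hw a ha).exists_isPacking
  simp only [Finset.mem_filter, Finset.mem_univ, true_and] at hcover
  have label_eq {a c x} (ha : a ≠ 0) (hc : c ∈ C a) (hx : x ∈ c) : w x = a :=
    (hcover a ha x).2 ⟨c, hc, hx⟩
  let D : Set (Cycle E) := {c | ∃ a ≠ 0, c ∈ C a}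
  have hD : G.IsPacking EdgeDisjoint D := by
    refine ⟨fun c ⟨a, ha, hc⟩ => (hC a ha).1 hc, ?_⟩
    rintro c ⟨a, ha, hc⟩ d ⟨b, hb, hd⟩ hcd x hxc hxd
    obtain rfl : a = b := (label_eq ha hc hxc).symm.trans (label_eq hb hd hxd)
    exact (hC a ha).2 hc hd hcd x hxc hxd
  refine ⟨D, hD, ?_, fun c ⟨a, ha, hc⟩ x hx => label_eq ha hc hx ▸ ha⟩
  refine mem_cycleSpan_of_forall_eq (G.finite_directedCycles.subset hD.1) hD.2 ?_ fun x hx => ?_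
  · exact fun c ⟨a, ha, hc⟩ => ⟨a, fun x hx => label_eq ha hc hx⟩
  · obtain ⟨c, hc, hxc⟩ := (hcover (w x) hx x).1 rfl
    exact ⟨c, ⟨w x, hx, hc⟩, hxc⟩

theorem IsPacking.isBalanced (hC : G.IsPacking EdgeDisjoint C) (hw : w ∈ cycleSpan K C) :
    G.IsBalanced w := by
  intro a ha
  have hCa : G.IsPacking EdgeDisjoint {c ∈ C | ∀ x ∈ c, w x = a} :=
    ⟨fun c hc => hC.1 hc.1, hC.2.mono (Set.sep_subset _ _)⟩
  refine hCa.isEulerian fun x => ?_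
  simp only [Finset.mem_filter, Finset.mem_univ, true_and]
  refine ⟨fun hx => ?_, fun ⟨c, hc, hxc⟩ => hc.2 x hxc⟩
  obtain ⟨c, hc, hxc⟩ := exists_mem_of_mem_cycleSpan hw (hx ▸ ha)
  obtain ⟨b, hb⟩ := exists_forall_eq_of_mem_cycleSpan hC.2 hw hc
  obtain rfl : b = a := (hb x hxc).symm.trans hx
  exact ⟨c, ⟨hc, hb⟩, hxc⟩

theorem isBalanced_iff_exists_isPacking :
    G.IsBalanced w ↔ ∃ C, G.IsPacking EdgeDisjoint C ∧ w ∈ cycleSpan K C :=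
  ⟨fun hw => let ⟨C, hC, hwC, _⟩ := hw.exists_isPacking; ⟨C, hC, hwC⟩,
    fun ⟨_, hC, hwC⟩ => hC.isBalanced hwC⟩

theorem isStronglyBalanced_iff_exists_isPacking :
    G.IsStronglyBalanced w ↔ ∃ C, G.IsPacking G.VertexDisjoint C ∧ w ∈ cycleSpan K C := by
  constructor
  · rintro ⟨hw, hinj⟩
    obtain ⟨C, hC, hwC, hsupp⟩ := hw.exists_isPacking
    refine ⟨C, ⟨hC.1, fun c hc d hd hcd v hvc hvd => ?_⟩, hwC⟩
    obtain ⟨x, hxc, rfl⟩ := Cycle.mem_map.1 hvc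
    obtain ⟨y, hyd, hyx⟩ := Cycle.mem_map.1 hvd
    obtain rfl : y = x := hinj (hsupp d hd y hyd) (hsupp c hc x hxc) hyx
    exact hC.2 hc hd hcd y hxc hyd
  · rintro ⟨C, hC, hwC⟩
    have hC' : G.IsPacking EdgeDisjoint C :=
      ⟨hC.1, hC.2.imp fun _ _ => VertexDisjoint.edgeDisjoint⟩
    refine ⟨hC'.isBalanced hwC, fun x hx y hy hxy => ?_⟩
    obtain ⟨c, hc, hxc⟩ := exists_mem_of_mem_cycleSpan hwC hx
    obtain ⟨d, hd, hyd⟩ := exists_mem_of_mem_cycleSpan hwC hy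
    have hvc : G.src x ∈ c.map G.src := Cycle.mem_map.2 ⟨x, hxc, rfl⟩
    have hvd : G.src x ∈ d.map G.src := Cycle.mem_map.2 ⟨y, hyd, hxy.symm⟩
    obtain rfl : c = d := by_contra fun hcd => hC.2 hc hd hcd _ hvc hvd
    exact (hC.1 hc).src_injOn hxc hyd hxy

end BalancedLabellings

section EdgeESymm

variable {E : Type*}

theorem isHomogeneous_edgeESymm (A : Finset E) (n : ℕ) : (edgeESymm A n).IsHomogeneous n := by
  rw [edgeESymm, Finset.esymm_map_val]
  refine MvPolynomial.IsHomogeneous.sum _ _ _ fun t ht => ?_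
  have h := MvPolynomial.IsHomogeneous.prod t (fun x => (MvPolynomial.X x : MvPolynomial E ℤ))
    (fun _ => 1) fun x _ => MvPolynomial.isHomogeneous_X ℤ x
  rwa [← (Finset.mem_powersetCard.1 ht).2, Finset.card_eq_sum_ones]

theorem aeval_edgeESymm {K : Type*} [CommRing K] (w : E → K) (A : Finset E) (n : ℕ) :
    MvPolynomial.aeval w (edgeESymm A n) = (A.val.map w).esymm n := by
  simp only [edgeESymm, Finset.esymm_map_val, map_sum, map_prod, MvPolynomial.aeval_X]

theorem esymm_map_eq_zero_of_aeval_edgeESymm_eq_zero {K : Type*} [CommRing K] {w : E → K}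
    {A : Finset E} {k : ℕ}
    (h : ∀ n, k ≤ n → n ≤ A.card → MvPolynomial.aeval w (edgeESymm A n) = 0)
    {n : ℕ} (hn : k ≤ n) : (A.val.map w).esymm n = 0 := by
  obtain hle | hlt := le_or_gt n A.card
  · rw [← aeval_edgeESymm, h n hn hle]
  · exact esymm_eq_zero_of_card_lt (by simpa using hlt)

end EdgeESymm

section IncidenceSets

variable {V E : Type*} [Fintype E] {G : DiMultigraph V E}

theorem count_map_filter_comm {α β : Type*} [DecidableEq α] [DecidableEq β] (f : E → α) (g : E → β)
    (a : α) (b : β) [DecidablePred (f · = a)] [DecidablePred (g · = b)] :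
    ((Finset.univ.filter fun x => g x = b).val.map f).count a =
      ((Finset.univ.filter fun x => f x = a).val.map g).count b := by
  rw [Multiset.count_map, Multiset.count_map, ← Finset.filter_val, ← Finset.filter_val,
    Finset.filter_filter, Finset.filter_filter]
  simp only [and_comm, eq_comm]

theorem isBalanced_iff_filter_ne_zero_eq {K : Type*} [Zero K] [DecidableEq K] {w : E → K} :
    G.IsBalanced w ↔ ∀ v,
      ((G.outEdges v).val.map w).filter (· ≠ 0) = ((G.inEdges v).val.map w).filter (· ≠ 0) := by
  classical
  have hcount : G.IsBalanced w ↔ ∀ a ≠ 0, ∀ v,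
      ((G.outEdges v).val.map w).count a = ((G.inEdges v).val.map w).count a := by
    refine forall₂_congr fun a _ => Multiset.ext.trans (forall_congr' fun v => ?_)
    rw [count_map_filter_comm G.src, count_map_filter_comm G.tgt, outEdges, inEdges]
  simp only [hcount, Multiset.ext, Multiset.count_filter]
  grind

theorem injOn_src_support_iff {K : Type*} [Zero K] [DecidableEq K] {w : E → K} :
    Set.InjOn G.src (Function.support w) ↔
      ∀ v, (((G.outEdges v).val.map w).filter (· ≠ 0)).card ≤ 1 := by
  have hcard (v : V) : (((G.outEdges v).val.map w).filter (· ≠ 0)).card =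
      ((G.outEdges v).filter fun x => w x ≠ 0).card := by
    rw [Multiset.filter_map, Multiset.card_map]
    rfl
  simp only [hcard, Finset.card_le_one]
  simp only [Finset.mem_filter, outEdges, Finset.mem_univ, true_and]
  exact ⟨fun h v x hx y hy => h hx.2 hy.2 (hx.1.trans hy.1.symm),
    fun h x hx y hy hxy => h _ x ⟨hxy, hx⟩ y ⟨rfl, hy⟩⟩

section Domain

variable {K : Type*} [CommRing K] [IsDomain K] {w : E → K}

theorem isBalanced_iff_esymm_eq :
    G.IsBalanced w ↔
      ∀ v n, ((G.outEdges v).val.map w).esymm n = ((G.inEdges v).val.map w).esymm n := by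
  classical
  simp only [isBalanced_iff_filter_ne_zero_eq, filter_ne_zero_eq_iff_esymm_eq]

theorem isStronglyBalanced_iff_esymm_eq :
    G.IsStronglyBalanced w ↔
      (∀ v n, ((G.outEdges v).val.map w).esymm n = ((G.inEdges v).val.map w).esymm n) ∧
        ∀ v, ∀ n > 1, ((G.outEdges v).val.map w).esymm n = 0 := by
  classical
  simp only [IsStronglyBalanced, isBalanced_iff_esymm_eq, injOn_src_support_iff,
    card_filter_ne_zero_le_iff_esymm_eq_zero]

end Domain

theorem mk_mem_incidenceSet_iff {w : E → ℂ} (hw : w ≠ 0) :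
    Projectivization.mk ℂ w hw ∈ G.incidenceSet ↔ G.IsBalanced w := by
  rw [incidenceSet, incidenceIdeal, projZeroLocus_span, mk_mem_projZeroLocus_iff,
    isBalanced_iff_esymm_eq]
  · constructor
    · intro h v n
      obtain rfl | hn := n.eq_zero_or_pos
      · simp [Multiset.esymm]
      obtain hle | hlt := le_or_gt n (max (G.outEdges v).card (G.inEdges v).card)
      · have hvn := h _ ⟨v, n, hn, hle, rfl⟩
        rwa [map_sub, aeval_edgeESymm, aeval_edgeESymm, sub_eq_zero] at hvn
      · rw [max_lt_iff] at hlt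
        rw [esymm_eq_zero_of_card_lt (by simpa using hlt.1),
          esymm_eq_zero_of_card_lt (by simpa using hlt.2)]
    · rintro h _ ⟨v, n, -, -, rfl⟩
      rw [map_sub, aeval_edgeESymm, aeval_edgeESymm, h, sub_self]
  · rintro _ ⟨v, n, -, -, rfl⟩
    exact ⟨n, (isHomogeneous_edgeESymm _ n).sub (isHomogeneous_edgeESymm _ n)⟩

theorem mk_mem_strongIncidenceSet_iff {w : E → ℂ} (hw : w ≠ 0) :
    Projectivization.mk ℂ w hw ∈ G.strongIncidenceSet ↔ G.IsStronglyBalanced w := by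
  rw [strongIncidenceSet, strongIncidenceIdeal, projZeroLocus_span, mk_mem_projZeroLocus_iff,
    isStronglyBalanced_iff_esymm_eq]
  · constructor
    · intro h
      have hout (v n) (hn : 2 ≤ n) : ((G.outEdges v).val.map w).esymm n = 0 :=
        esymm_map_eq_zero_of_aeval_edgeESymm_eq_zero
          (fun n hn hle => h _ (.inl (.inr ⟨v, n, hn, hle, rfl⟩))) hn
      have hin (v n) (hn : 2 ≤ n) : ((G.inEdges v).val.map w).esymm n = 0 :=
        esymm_map_eq_zero_of_aeval_edgeESymm_eq_zero
          (fun n hn hle => h _ (.inr ⟨v, n, hn, hle, rfl⟩)) hn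
      refine ⟨fun v n => ?_, hout⟩
      match n with
      | 0 => simp [Multiset.esymm]
      | 1 =>
        have hv := h _ (.inl (.inl ⟨v, rfl⟩))
        rwa [map_sub, aeval_edgeESymm, aeval_edgeESymm, sub_eq_zero] at hv
      | n + 2 => rw [hout v (n + 2) (by lia), hin v (n + 2) (by lia)]
    · rintro ⟨heq, hzero⟩ _ ((⟨v, rfl⟩ | ⟨v, n, hn, -, rfl⟩) | ⟨v, n, hn, -, rfl⟩)
      · rw [map_sub, aeval_edgeESymm, aeval_edgeESymm, heq, sub_self]
      · rw [aeval_edgeESymm, hzero v n hn]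
      · rw [aeval_edgeESymm, ← heq, hzero v n hn]
  · rintro _ ((⟨v, rfl⟩ | ⟨v, n, -, -, rfl⟩) | ⟨v, n, -, -, rfl⟩)
    · exact ⟨1, (isHomogeneous_edgeESymm _ 1).sub (isHomogeneous_edgeESymm _ 1)⟩
    · exact ⟨n, isHomogeneous_edgeESymm _ n⟩
    · exact ⟨n, isHomogeneous_edgeESymm _ n⟩

end IncidenceSets

section PackingLocus

variable {V E : Type*} {G : DiMultigraph V E} {R : Cycle E → Cycle E → Prop}

/-- The union of the linear subspaces of projective space spanned by the packings of directed cycles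
with respect to `R`. -/
def packingLocus (G : DiMultigraph V E) (R : Cycle E → Cycle E → Prop) : Set (ℙ ℂ (E → ℂ)) :=
  ⋃₀ ((fun C => ((cycleSpan ℂ C).projectivization : Set (ℙ ℂ (E → ℂ)))) '' {C | G.IsPacking R C})

theorem mk_mem_packingLocus_iff {w : E → ℂ} (hw : w ≠ 0) :
    Projectivization.mk ℂ w hw ∈ G.packingLocus R ↔ ∃ C, G.IsPacking R C ∧ w ∈ cycleSpan ℂ C := by
  simp [packingLocus]

theorem incidenceSet_eq_packingLocus [Fintype E] (G : DiMultigraph V E) :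
    G.incidenceSet = G.packingLocus EdgeDisjoint := by
  ext p
  induction p using Projectivization.ind with | h w hw
  rw [mk_mem_incidenceSet_iff, mk_mem_packingLocus_iff, isBalanced_iff_exists_isPacking]

theorem strongIncidenceSet_eq_packingLocus [Fintype E] (G : DiMultigraph V E) :
    G.strongIncidenceSet = G.packingLocus G.VertexDisjoint := by
  ext p
  induction p using Projectivization.ind with | h w hw
  rw [mk_mem_strongIncidenceSet_iff, mk_mem_packingLocus_iff,
    isStronglyBalanced_iff_exists_isPacking]

theorem packingLocus_eq_projectivization (h : G.directedCycles.Pairwise R) :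
    G.packingLocus R = (cycleSpan ℂ G.directedCycles).projectivization := by
  ext p
  induction p using Projectivization.ind with | h w hw
  rw [mk_mem_packingLocus_iff, SetLike.mem_coe, Submodule.mk_mem_projectivization_iff]
  exact ⟨fun ⟨C, hC, hwC⟩ => cycleSpan_mono hC.1 hwC, fun hw => ⟨_, ⟨subset_rfl, h⟩, hw⟩⟩

variable [Finite E]

theorem pairwise_directedCycles_of_isProjVariety (hR : ∀ c d, R c d → EdgeDisjoint c d)
    (h : IsProjVariety (G.packingLocus R)) : G.directedCycles.Pairwise R := by
  have hfin : {C | G.IsPacking R C}.Finite :=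
    G.finite_directedCycles.finite_subsets.subset fun C hC => hC.1
  have hempty : G.IsPacking R ∅ := ⟨Set.empty_subset _, Set.pairwise_empty _⟩
  obtain ⟨C, hC, hlocus⟩ := h.mem_of_eq_sUnion (hfin.image _) (.image _ ⟨∅, hempty⟩)
    (by rintro _ ⟨C, -, rfl⟩; exact isProjAlgebraicSet_projectivization _) rfl
  refine hC.2.mono fun c hc => ?_
  have hsingle : G.IsPacking R {c} :=
    ⟨Set.singleton_subset_iff.2 hc, Set.pairwise_singleton _ _⟩
  have hcC : Projectivization.mk ℂ _ (hc.cycleVec_ne_zero (K := ℂ)) ∈ G.packingLocus R :=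
    (mk_mem_packingLocus_iff _).2 ⟨{c}, hsingle, cycleVec_mem_cycleSpan rfl⟩
  rw [← hlocus] at hcC
  have hC' : G.IsPacking EdgeDisjoint C := ⟨hC.1, hC.2.imp hR⟩
  exact hC'.mem_of_cycleVec_mem_cycleSpan hc hcC

theorem tfae_isProjVariety_packingLocus (hR : ∀ c d, R c d → EdgeDisjoint c d) :
    [IsProjVariety (G.packingLocus R), IsProjLinearSubspace (G.packingLocus R),
      G.directedCycles.Pairwise R].TFAE := by
  tfae_have 1 → 3 := pairwise_directedCycles_of_isProjVariety hR
  tfae_have 3 → 2 := fun h => ⟨_, (packingLocus_eq_projectivization h).symm⟩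
  tfae_have 2 → 1 := IsProjLinearSubspace.isProjVariety
  tfae_finish

end PackingLocus

section CountingCycles

variable {V E : Type*} [Finite E] (G : DiMultigraph V E)

theorem encard_directedCycles_eq_alpha_iff :
    G.directedCycles.encard = G.alpha ↔ G.directedCycles.Pairwise EdgeDisjoint :=
  encard_eq_iff_pairwise_of_isGreatest G.finite_directedCycles G.isGreatest_alpha

theorem encard_directedCycles_eq_strongAlpha_iff :
    G.directedCycles.encard = G.strongAlpha ↔ G.directedCycles.Pairwise G.VertexDisjoint :=
  encard_eq_iff_pairwise_of_isGreatest G.finite_directedCycles G.isGreatest_strongAlpha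

end CountingCycles

end DiMultigraph

theorem mainTheorem4_general {V E : Type*} [Fintype E] (G : DiMultigraph V E) :
    List.TFAE [
      IsProjVariety G.incidenceSet,
      IsProjLinearSubspace G.incidenceSet,
      G.directedCycles.encard = (G.alpha : ℕ∞)] ∧
    List.TFAE [
      IsProjVariety G.strongIncidenceSet,
      IsProjLinearSubspace G.strongIncidenceSet,
      G.directedCycles.encard = (G.strongAlpha : ℕ∞)] ∧
    (IsProjVariety G.strongIncidenceSet → G.incidenceSet = G.strongIncidenceSet) := by
  rw [G.incidenceSet_eq_packingLocus, G.strongIncidenceSet_eq_packingLocus,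
    G.encard_directedCycles_eq_alpha_iff, G.encard_directedCycles_eq_strongAlpha_iff]
  have edgeDisjoint (c d : Cycle E) : G.VertexDisjoint c d → DiMultigraph.EdgeDisjoint c d :=
    DiMultigraph.VertexDisjoint.edgeDisjoint
  refine ⟨DiMultigraph.tfae_isProjVariety_packingLocus fun _ _ => id,
    DiMultigraph.tfae_isProjVariety_packingLocus edgeDisjoint, fun h => ?_⟩
  have hvertex := DiMultigraph.pairwise_directedCycles_of_isProjVariety edgeDisjoint h
  have hedge := hvertex.imp edgeDisjoint
  rw [DiMultigraph.packingLocus_eq_projectivization hedge,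
    DiMultigraph.packingLocus_eq_projectivization hvertex]

theorem mainTheorem4 {V E : Type*} [Fintype V] [Fintype E] (G : DiMultigraph V E) :
    List.TFAE [
      IsProjVariety G.incidenceSet,
      IsProjLinearSubspace G.incidenceSet,
      G.directedCycles.encard = (G.alpha : ℕ∞)] ∧
    List.TFAE [
      IsProjVariety G.strongIncidenceSet,
      IsProjLinearSubspace G.strongIncidenceSet,
      G.directedCycles.encard = (G.strongAlpha : ℕ∞)] ∧
    (IsProjVariety G.strongIncidenceSet → G.incidenceSet = G.strongIncidenceSet) :=
  mainTheorem4_general G
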